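/- Let $S\subset\mathbb R^3$ be closed, let $Q\subset\mathbb R^3\setminus S$ be compact, let $\rho$ be a finite positive Borel measure on $\mathbb R^3$ with support contained in $Q$, and let $v\in\mathbb R^3$ be a unit vector. Let $\mathcal M(S)$ be the space of finite signed Borel measures on $\mathbb R^3$ whose support lies in $S$. For $\boldsymbol\mu\in\mathcal M(S)^3$ let $|\boldsymbol\mu|$ be its total variation measure, $\|\boldsymbol\mu\|_{TV}=|\boldsymbol\mu|(\mathbb R^3)$, and let $\mathbf u_{\boldsymbol\mu}=d\boldsymbol\mu/d|\boldsymbol\mu|$ be the Radon–Nikodym derivative. With $\mu_0=4\pi\cdot 10^{-7}$ and $$\mathbf K_v(z)=\frac{v}{|z|^3}-3\,z\,\frac{v\cdot z}{|z|^5}\qquad(z\neq 0),$$ define the forward operator $A:\mathcal M(S)^3\to L^2(Q,\rho)$ and the operator $A^*$ by $$A(\boldsymbol\mu)(x)=-\frac{\mu_0}{4\pi}\int \mathbf K_v(x-y)\cdot d\boldsymbol\mu(y)\quad(x\in Q),\qquad A^*(\Psi)(x)=-\frac{\mu_0}{4\pi}\int \Psi(y)\,\mathbf K_v(x-y)\,d\rho(y)\quad(x\in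 S,\ \Psi\in L^2(Q,\rho)).$$ Let $f\in L^2(Q,\rho)$ and $\lambda>0$, and call $\boldsymbol\mu\in\mathcal M(S)^3$ a solution if it minimizes $$\mathcal F_{f,\lambda}(\boldsymbol\mu)=\|f-A\boldsymbol\mu\|_{L^2(Q,\rho)}^2+\lambda\|\boldsymbol\mu\|_{TV}$$ over $\mathcal M(S)^3$. **Theorem.** A solution exists. A measure $\boldsymbol\mu_\lambda\in\mathcal M(S)^3$ is a solution if and only if $$A^*(f-A\boldsymbol\mu_\lambda)=\tfrac{\lambda}{2}\,\mathbf u_{\boldsymbol\mu_\lambda}\quad |\boldsymbol\mu_\lambda|\text{-a.e.}\qquad\text{and}\qquad |A^*(f-A\boldsymbol\mu_\lambda)|\le\tfrac{\lambda}{2}\quad\text{everywhere on } S.$$ Moreover, if $\boldsymbol\mu_\lambda$ is a solution, then $\boldsymbol\mu_\lambda'\in\mathcal M(S)^3$ is a solution if and only if (a) $A(\boldsymbol\mu_\lambda'-\boldsymbol\mu_\lambda)=0$, and (b) there are a non-negative $|\boldsymbol\mu_\lambda|$-integrable function $g$ and a finite positive Borel measure $\nu_s$, singular to $|\boldsymbol\mu_\lambda|$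 and with support contained in $\{x\in S:\ |A^*(f-A\boldsymbol\mu_\lambda)(x)|=\lambda/2\}$, such that $$d\boldsymbol\mu_\lambda'=g\,d\boldsymbol\mu_\lambda+\tfrac{2}{\lambda}A^*(f-A\boldsymbol\mu_\lambda)\,d\nu_s.$$ -/

import Mathlib

open MeasureTheory Set
open scoped ENNReal

noncomputable section

namespace EP2

/-- Euclidean space `ℝ³`. -/
abbrev R3 : Type := EuclideanSpace ℝ (Fin 3)

/-- The `i`-th component of an `ℝ³`-valued measure, as a signed measure. -/
def component (i : Fin 3) (μ : VectorMeasure R3 R3) : SignedMeasure R3 :=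
  μ.mapRange (EuclideanSpace.proj (𝕜 := ℝ) i).toLinearMap.toAddMonoidHom
    (EuclideanSpace.proj (𝕜 := ℝ) i).continuous

@[simp] lemma component_apply (i : Fin 3) (μ : VectorMeasure R3 R3) (E : Set R3) :
    component i μ E = μ E i := rfl

/-- The total variation measure of an `ℝ³`-valued measure is finite. -/
instance isFiniteMeasure_variation (μ : VectorMeasure R3 R3) :
    IsFiniteMeasure μ.variation := by
  have h : μ.variation ≤ ∑ i : Fin 3, (component i μ).totalVariation := by
    refine VectorMeasure.variation_le_of_forall_enorm_le fun E _ ↦ ?_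
    have h1 : ‖μ E‖ₑ ≤ ∑ i : Fin 3, ‖μ E i‖ₑ := by
      conv_lhs => rw [← (EuclideanSpace.basisFun (Fin 3) ℝ).sum_repr (μ E)]
      refine (enorm_sum_le _ _).trans (Finset.sum_le_sum fun i _ ↦ ?_)
      rw [enorm_smul]
      simp [enorm_eq_nnnorm]
    refine h1.trans ?_
    rw [Measure.finsetSum_apply]
    exact Finset.sum_le_sum fun i _ ↦ (component i μ).enorm_le_totalVariation E
  exact isFiniteMeasure_of_le _ h

/-- `𝓜(S)³`: the finite `ℝ³`-valued Borel measures on `ℝ³` whose support lies in `S`. -/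
def magnetizations (S : Set R3) : Submodule ℝ (VectorMeasure R3 R3) where
  carrier := {μ | μ.variation.support ⊆ S}
  zero_mem' := by simp
  add_mem' {μ ν} hμ hν := by
    refine (Measure.support_mono VectorMeasure.variation_add_le).trans ?_
    rw [Measure.support_add]
    exact union_subset hμ hν
  smul_mem' c μ hμ := by
    refine Subset.trans (Measure.AbsolutelyContinuous.support_mono ?_) hμ
    rw [VectorMeasure.variation_smul]
    exact Measure.smul_absolutelyContinuous

/-- The total variation norm `‖μ‖_TV = |μ|(ℝ³)`. -/
def tvNorm (μ : VectorMeasure R3 R3) : ℝ := μ.variation.real univ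

/-- The Radon–Nikodym derivative `u_μ = dμ/d|μ|`. -/
def polarDensity (μ : VectorMeasure R3 R3) (x : R3) : R3 :=
  WithLp.toLp 2 fun i ↦ (component i μ).rnDeriv μ.variation x

/-- The magnetic constant `μ₀ = 4π · 10⁻⁷`. -/
def magneticConstant : ℝ := 4 * Real.pi * (10 : ℝ)⁻¹ ^ 7

/-- The kernel `K_v(z) = v / |z|³ - 3 (v·z) z / |z|⁵`. -/
def kernel (v z : R3) : R3 :=
  (1 / ‖z‖ ^ 3) • v - (3 * inner ℝ v z / ‖z‖ ^ 5) • z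

/-- The component `b_v(μ)(x) = -(μ₀/4π) ∫ K_v(x-y) · dμ(y)` in the direction `v` of the magnetic
field generated by `μ`, at points `x` off the support of `μ`. -/
def fieldComponent (v : R3) (μ : VectorMeasure R3 R3) (x : R3) : ℝ :=
  -(magneticConstant / (4 * Real.pi)) * VectorMeasure.integral μ (fun y ↦ kernel v (x - y))
    (innerSL ℝ)

lemma measurable_kernel (v : R3) : Measurable (kernel v) := by
  unfold kernel; fun_prop

lemma continuousAt_kernel (v : R3) {z : R3} (hz : z ≠ 0) : ContinuousAt (kernel v) z := by
  have h : ‖z‖ ≠ 0 := norm_ne_zero_iff.2 hz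
  unfold kernel
  fun_prop (disch := positivity)

lemma norm_kernel_le (v : R3) {z : R3} {r : ℝ} (hr : 0 < r) (hz : r ≤ ‖z‖) :
    ‖kernel v z‖ ≤ 4 * ‖v‖ / r ^ 3 := by
  have h : 0 < ‖z‖ := hr.trans_le hz
  have h1 : ‖(1 / ‖z‖ ^ 3) • v‖ = ‖v‖ / ‖z‖ ^ 3 := by
    rw [norm_smul, Real.norm_of_nonneg (by positivity)]; ring
  have h2 : ‖(3 * inner ℝ v z / ‖z‖ ^ 5) • z‖ ≤ 3 * ‖v‖ / ‖z‖ ^ 3 := by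
    rw [norm_smul, norm_div, norm_mul, norm_pow, norm_norm, Real.norm_of_nonneg (by norm_num)]
    have := norm_inner_le_norm (𝕜 := ℝ) v z
    calc 3 * ‖inner ℝ v z‖ / ‖z‖ ^ 5 * ‖z‖ ≤ 3 * (‖v‖ * ‖z‖) / ‖z‖ ^ 5 * ‖z‖ := by gcongr
      _ = 3 * ‖v‖ / ‖z‖ ^ 3 := by field_simp
  calc ‖kernel v z‖ ≤ ‖v‖ / ‖z‖ ^ 3 + 3 * ‖v‖ / ‖z‖ ^ 3 :=
        (norm_sub_le _ _).trans (add_le_add h1.le h2)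
    _ = 4 * ‖v‖ / ‖z‖ ^ 3 := by ring
    _ ≤ 4 * ‖v‖ / r ^ 3 := by gcongr

/-- Two disjoint sets, one closed and one compact, are positively separated. -/
lemma exists_separation {S Q : Set R3} (hS : IsClosed S) (hQ : IsCompact Q) (hQS : Q ⊆ Sᶜ) :
    ∃ r > 0, ∀ x ∈ Q, ∀ y ∈ S, r ≤ ‖x - y‖ := by
  obtain ⟨r, hr, h⟩ := Metric.exists_pos_forall_lt_edist hQ hS
    (Set.disjoint_left.2 fun x hx hxS ↦ hQS hx hxS)
  refine ⟨r, hr, fun x hx y hy ↦ ?_⟩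
  have := (h x hx y hy).le
  rw [edist_dist, dist_eq_norm, ← ENNReal.ofReal_coe_nnreal] at this
  exact (ENNReal.ofReal_le_ofReal_iff (norm_nonneg _)).1 this

/-- If `μ` is supported in `S`, then `b_v(μ)` is continuous on `Q`. -/
lemma continuousOn_fieldComponent {S Q : Set R3} (hS : IsClosed S) (hQ : IsCompact Q)
    (hQS : Q ⊆ Sᶜ) (v : R3) (μ : magnetizations S) :
    ContinuousOn (fieldComponent v μ.1) Q := by
  obtain ⟨r, hr, h⟩ := exists_separation hS hQ hQS
  have hae : ∀ᵐ y ∂μ.1.variation, y ∈ S :=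
    Filter.mem_of_superset Measure.support_mem_ae μ.2
  refine ContinuousOn.mul continuousOn_const ?_
  refine VectorMeasure.continuousOn_of_dominated (bound := fun _ ↦ 4 * ‖v‖ / r ^ 3) ?_ ?_
    (integrable_const _) ?_
  · intro x _
    exact ((measurable_kernel v).comp (measurable_const.sub measurable_id)).aestronglyMeasurable
  · intro x hx
    filter_upwards [hae] with y hy using norm_kernel_le v hr (h x hx y hy)
  · filter_upwards [hae] with y hy x hx
    have hne : x - y ≠ 0 := norm_pos_iff.1 (hr.trans_le (h x hx y hy))
    exact (ContinuousAt.comp (f := fun x : R3 ↦ x - y) (continuousAt_kernel v hne)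
      (by fun_prop)).continuousWithinAt

lemma memLp_fieldComponent {S Q : Set R3} (hS : IsClosed S) (hQ : IsCompact Q) (hQS : Q ⊆ Sᶜ)
    (ρ : Measure R3) [IsFiniteMeasure ρ] (hρ : ρ.support ⊆ Q) (v : R3) (μ : magnetizations S) :
    MemLp (fieldComponent v μ.1) 2 ρ := by
  have hc := continuousOn_fieldComponent hS hQ hQS v μ
  have hae : Q ∈ ae ρ := Filter.mem_of_superset Measure.support_mem_ae hρ
  obtain ⟨C, hC⟩ := hQ.exists_bound_of_continuousOn hc
  have hm := hc.aestronglyMeasurable (μ := ρ) hQ.measurableSet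
  rw [Measure.restrict_eq_self_of_ae_mem hae] at hm
  refine MemLp.of_bound hm C ?_
  filter_upwards [hae] with x hx using hC x hx

/-- The forward operator `A : 𝓜(S)³ → L²(Q, ρ)`, `A(μ)(x) = b_v(μ)(x)` for `x ∈ Q`. As `ρ` is
supported in `Q`, the space `L²(Q, ρ)` is `L²(ρ)`. -/
def forward {S Q : Set R3} (hS : IsClosed S) (hQ : IsCompact Q) (hQS : Q ⊆ Sᶜ)
    (ρ : Measure R3) [IsFiniteMeasure ρ] (hρ : ρ.support ⊆ Q) (v : R3) (μ : magnetizations S) :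
    Lp ℝ 2 ρ :=
  (memLp_fieldComponent hS hQ hQS ρ hρ v μ).toLp (fieldComponent v μ.1)

/-- The adjoint operator `A*(Ψ)(x) = -(μ₀/4π) ∫ Ψ(y) K_v(x-y) dρ(y)`, for `x ∈ S`. -/
def adjoint (ρ : Measure R3) (v : R3) (Ψ : Lp ℝ 2 ρ) (x : R3) : R3 :=
  -(magneticConstant / (4 * Real.pi)) • ∫ y, Ψ y • kernel v (x - y) ∂ρ

/-- The functional `𝓕_{f,λ}(μ) = ‖f - Aμ‖² + λ ‖μ‖_TV`. -/
def functional {S Q : Set R3} (hS : IsClosed S) (hQ : IsCompact Q) (hQS : Q ⊆ Sᶜ)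
    (ρ : Measure R3) [IsFiniteMeasure ρ] (hρ : ρ.support ⊆ Q) (v : R3) (f : Lp ℝ 2 ρ) (lam : ℝ)
    (μ : magnetizations S) : ℝ :=
  ‖f - forward hS hQ hQS ρ hρ v μ‖ ^ 2 + lam * tvNorm μ.1

/-- `μ` solves the extremal problem: it minimizes `𝓕_{f,λ}` over `𝓜(S)³`. -/
def IsSolution {S Q : Set R3} (hS : IsClosed S) (hQ : IsCompact Q) (hQS : Q ⊆ Sᶜ)
    (ρ : Measure R3) [IsFiniteMeasure ρ] (hρ : ρ.support ⊆ Q) (v : R3) (f : Lp ℝ 2 ρ) (lam : ℝ)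
    (μ : magnetizations S) : Prop :=
  ∀ ν : magnetizations S,
    functional hS hQ hQS ρ hρ v f lam μ ≤ functional hS hQ hQS ρ hρ v f lam ν

end EP2

end

open MeasureTheory Set
open scoped ENNReal

noncomputable section

/-! ### Integration against vector measures with a density -/

namespace MeasureTheory

section WithDensity

/-! The functional is a convex least-squares term plus a multiple of a norm, and everything rests on
the adjoint identity `inner_forward`: ⟨Ψ, Aμ⟩ = ∫ A*Ψ · dμ.

Existence: a magnetization is encoded as a positive measure on dipoles (location, moment in the unit
ball), so that compactness is only needed for positive measures. Mass may escape to infinity when S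
is unbounded, but A*Ψ decays there; multiplying by a decaying weight makes a minimizing sequence
tight, and dividing the limit by the weight gives a finite measure whose mass has not increased
(`exists_vague_limit`). Pairing with the limiting residual gives lower semicontinuity.

Optimality: put Ψ = f - Aμ. Expanding the square (`functional_eq`) shows that μ is a solution iff
⟨Ψ, Aν⟩ ≤ (λ/2)‖ν‖ for all ν, with equality at ν = μ. Testing on point dipoles, the inequality says
|A*Ψ| ≤ λ/2 on S; equality then forces A*Ψ = (λ/2)u a.e.

Solution set: the quadratic term of the expansion vanishes between two solutions, so they share Aμ,
hence Ψ, and both have polar density (2/λ)A*Ψ. They differ only in their variations, and the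
Lebesgue decomposition of |μ'| with respect to |μ| yields g and the singular part. Conversely, a
measure of that form attains equality in the duality. -/

lemma lintegral_enorm_variation_withDensityᵥ {X E F : Type*} {mX : MeasurableSpace X}
    [NormedAddCommGroup E] [NormedAddCommGroup F] [NormedSpace ℝ F] [CompleteSpace F]
    {τ : Measure X} {h : X → F} {f : X → E} (hh : Integrable h τ) (hf : StronglyMeasurable f) :
    ∫⁻ x, ‖f x‖ₑ ∂(τ.withDensityᵥ h).variation = ∫⁻ x, ‖h x‖ₑ * ‖f x‖ₑ ∂τ := by
  rw [Measure.variation_withDensityᵥ hh,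
    lintegral_withDensity_eq_lintegral_mul₀ hh.1.enorm hf.enorm.aemeasurable]
  rfl

variable {X E F G : Type*} {mX : MeasurableSpace X}
  [NormedAddCommGroup E] [NormedSpace ℝ E] [NormedAddCommGroup F] [NormedSpace ℝ F]
  [CompleteSpace F] [NormedAddCommGroup G] [NormedSpace ℝ G]
  {τ : Measure X} {h : X → F} {f : X → E}

/-- The variation of h dτ is |h| dτ, which does not see the zeros of h. Nothing is lost in the
pairings below, since they vanish there. -/
lemma ae_of_ae_variation_withDensityᵥ (hh : Integrable h τ) {p : X → Prop}
    (hp : ∀ᵐ x ∂(τ.withDensityᵥ h).variation, p x) : ∀ᵐ x ∂τ, h x ≠ 0 → p x := by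
  rw [Measure.variation_withDensityᵥ hh, ae_withDensity_iff' hh.1.enorm] at hp
  filter_upwards [hp] with x hx h0 using hx (by simpa using h0)

/-- Pairing an integrable function with a vector measure given by a density against a positive
measure produces an integrable function. -/
lemma integrable_bilin_of_integrable_withDensityᵥ (B : E →L[ℝ] F →L[ℝ] G) (hh : Integrable h τ)
    (hf : (τ.withDensityᵥ h).Integrable f) : Integrable (fun x ↦ B (f x) (h x)) τ := by
  have hcongr : ∀ᵐ x ∂τ, B (hf.1.mk f x) (h x) = B (f x) (h x) := by
    filter_upwards [ae_of_ae_variation_withDensityᵥ hh hf.1.ae_eq_mk] with x hx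
    by_cases h0 : h x = 0
    · simp [h0]
    · rw [hx h0]
  refine Integrable.congr ?_ hcongr
  refine ⟨B.aestronglyMeasurable_comp₂ hf.1.stronglyMeasurable_mk.aestronglyMeasurable hh.1, ?_⟩
  have h1 : ∫⁻ x, ‖hf.1.mk f x‖ₑ ∂(τ.withDensityᵥ h).variation < ∞ :=
    (hf.congr hf.1.ae_eq_mk).2
  rw [lintegral_enorm_variation_withDensityᵥ hh hf.1.stronglyMeasurable_mk] at h1
  calc ∫⁻ x, ‖B (hf.1.mk f x) (h x)‖ₑ ∂τ
      ≤ ∫⁻ x, ‖B‖ₑ * (‖h x‖ₑ * ‖hf.1.mk f x‖ₑ) ∂τ := by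
        refine lintegral_mono fun x ↦ ?_
        refine (B.le_opENorm₂ _ _).trans_eq ?_
        ring
    _ = ‖B‖ₑ * ∫⁻ x, ‖h x‖ₑ * ‖hf.1.mk f x‖ₑ ∂τ := lintegral_const_mul' _ _ (by simp)
    _ < ∞ := ENNReal.mul_lt_top (by simp) h1

/-- Integration against a vector measure given by a density against a positive measure. -/
lemma integral_withDensityᵥ [CompleteSpace G] (B : E →L[ℝ] F →L[ℝ] G) (hh : Integrable h τ)
    (hf : (τ.withDensityᵥ h).Integrable f) :
    (τ.withDensityᵥ h).integral f B = ∫ x, B (f x) (h x) ∂τ := by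
  refine Integrable.induction
    (P := fun f ↦ (τ.withDensityᵥ h).integral f B = ∫ x, B (f x) (h x) ∂τ) ?_ ?_ ?_ ?_ hf
  · intro c s hs hlt
    have : IsFiniteMeasure ((τ.withDensityᵥ h).variation.restrict s) := ⟨by simpa using hlt⟩
    rw [VectorMeasure.integral_indicator_const c hs, withDensityᵥ_apply hh hs,
      ← ContinuousLinearMap.integral_comp_comm _ hh.integrableOn, ← integral_indicator hs]
    refine integral_congr_ae (.of_forall fun x ↦ ?_)
    by_cases hx : x ∈ s <;> simp [hx]
  · intro f g _ hf hg h1 h2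
    rw [VectorMeasure.integral_add hf hg, h1, h2, ← integral_add
      (integrable_bilin_of_integrable_withDensityᵥ B hh hf)
      (integrable_bilin_of_integrable_withDensityᵥ B hh hg)]
    simp
  -- Both sides are continuous on L¹ of the variation: |B(f, h)| ≤ ‖B‖ |f| |h|, and |h| dτ is the
  -- variation.
  · refine isClosed_eq VectorMeasure.continuous_integral ?_
    refine LipschitzWith.continuous (K := ‖B‖₊) fun f g ↦ ?_
    have hf := integrable_bilin_of_integrable_withDensityᵥ B hh (L1.integrable_coeFn f)
    have hg := integrable_bilin_of_integrable_withDensityᵥ B hh (L1.integrable_coeFn g)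
    rw [edist_eq_enorm_sub, ← integral_sub hf hg, L1.edist_def]
    simp only [edist_eq_enorm_sub]
    rw [lintegral_enorm_variation_withDensityᵥ (f := fun x ↦ f x - g x) hh
      ((Lp.stronglyMeasurable f).sub (Lp.stronglyMeasurable g))]
    refine (enorm_integral_le_lintegral_enorm _).trans ?_
    rw [← enorm_eq_nnnorm, ← lintegral_const_mul' _ _ (by simp)]
    refine lintegral_mono fun x ↦ ?_
    have := B.le_opENorm₂ (f x - g x) (h x)
    simp only [map_sub, _root_.sub_apply] at this
    refine this.trans_eq ?_
    ring
  · intro f g hfg _ h1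
    rw [← VectorMeasure.integral_congr_ae hfg, h1]
    refine integral_congr_ae ?_
    filter_upwards [ae_of_ae_variation_withDensityᵥ hh hfg] with x hx
    by_cases h0 : h x = 0
    · simp [h0]
    · rw [hx h0]

/-- Turns g dμ into a density against a positive measure, for which variations and integrals are
explicit. -/
lemma withDensity_withDensityᵥ {g : X → ℝ} (hh : Integrable h τ)
    (hg : (τ.withDensityᵥ h).Integrable g) :
    (τ.withDensityᵥ h).withDensity g (ContinuousLinearMap.lsmul ℝ ℝ) =
      τ.withDensityᵥ fun x ↦ g x • h x := by
  ext s hs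
  have hr : (τ.withDensityᵥ h).restrict s = (τ.restrict s).withDensityᵥ h := by
    ext t ht
    rw [VectorMeasure.restrict_apply _ hs ht, withDensityᵥ_apply hh (ht.inter hs),
      withDensityᵥ_apply hh.restrict ht, Measure.restrict_restrict ht]
  have hgh : Integrable (fun x ↦ g x • h x) τ :=
    integrable_bilin_of_integrable_withDensityᵥ (ContinuousLinearMap.lsmul ℝ ℝ) hh hg
  rw [VectorMeasure.withDensity_apply hg, withDensityᵥ_apply hgh hs, hr,
    integral_withDensityᵥ _ hh.restrict]
  · simp
  · rw [← hr]; exact VectorMeasure.Integrable.restrict hg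

end WithDensity

lemma add_withDensityᵥ {X F : Type*} {mX : MeasurableSpace X} [NormedAddCommGroup F]
    [NormedSpace ℝ F] {τ σ : Measure X} {h : X → F}
    (h1 : Integrable h τ) (h2 : Integrable h σ) :
    (τ + σ).withDensityᵥ h = τ.withDensityᵥ h + σ.withDensityᵥ h := by
  ext s hs
  rw [withDensityᵥ_apply (h1.add_measure h2) hs, _root_.add_apply,
    withDensityᵥ_apply h1 hs, withDensityᵥ_apply h2 hs, Measure.restrict_add,
    integral_add_measure h1.integrableOn h2.integrableOn]

lemma Measure.support_subset_iff_measure_compl_eq_zero {X : Type*} [TopologicalSpace X]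
    [HereditarilyLindelofSpace X] [MeasurableSpace X] {τ : Measure X} {S : Set X}
    (hS : IsClosed S) : τ.support ⊆ S ↔ τ Sᶜ = 0 := by
  refine ⟨fun h ↦ measure_mono_null (compl_subset_compl.2 h) Measure.support_mem_ae,
    fun h x hx ↦ ?_⟩
  by_contra hxS
  exact ((Measure.mem_support_iff_forall x).1 hx _ (hS.isOpen_compl.mem_nhds hxS)).ne' h

end MeasureTheory

/-! ### Polar decomposition -/

namespace EP2

variable (μ : VectorMeasure R3 R3)

lemma measurable_polarDensity : Measurable (polarDensity μ) := by
  unfold polarDensity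
  exact (PiLp.continuous_toLp 2 _).measurable.comp
    (measurable_pi_lambda _ fun i ↦ (component i μ).measurable_rnDeriv _)

lemma integrable_polarDensity : Integrable (polarDensity μ) μ.variation := by
  rw [integrable_piLp_iff]
  exact fun i ↦ (component i μ).integrable_rnDeriv _

/-- The polar decomposition `dμ = u_μ d|μ|`. -/
lemma variation_withDensityᵥ_polarDensity :
    μ.variation.withDensityᵥ (polarDensity μ) = μ := by
  ext s hs i
  rw [withDensityᵥ_apply (integrable_polarDensity μ) hs]
  -- Since |μ(t)| ≤ |μ|(t), each component vanishes on |μ|-null sets and the signed Radon–Nikodym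
  -- theorem applies.
  have h : component i μ ≪ᵥ μ.variation.toENNRealVectorMeasure := by
    refine VectorMeasure.AbsolutelyContinuous.mk fun t ht h0 ↦ ?_
    rw [Measure.toENNRealVectorMeasure_apply_measurable ht] at h0
    have : μ t = 0 := by
      have := μ.enorm_measure_le_variation t
      simpa [h0] using this
    simp [this]
  have h2 := congrArg (fun m ↦ m s) ((component i μ).withDensityᵥ_rnDeriv_eq μ.variation h)
  simp only [component_apply] at h2
  rw [← h2, withDensityᵥ_apply ((component i μ).integrable_rnDeriv _) hs]
  exact ((EuclideanSpace.proj (𝕜 := ℝ) i).integral_comp_comm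
    (integrable_polarDensity μ).integrableOn).symm

/-- Taking variations in dμ = u d|μ| gives d|μ| = |u| d|μ|, and densities are unique. -/
lemma norm_polarDensity : ∀ᵐ x ∂μ.variation, ‖polarDensity μ x‖ = 1 := by
  have h := Measure.variation_withDensityᵥ (integrable_polarDensity μ)
  rw [variation_withDensityᵥ_polarDensity] at h
  have h2 : μ.variation.withDensity (fun _ ↦ 1) =
      μ.variation.withDensity fun x ↦ ‖polarDensity μ x‖ₑ := by
    rw [← h]; exact withDensity_one
  rw [withDensity_eq_iff aemeasurable_const (measurable_polarDensity μ).enorm.aemeasurable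
    (by simp)] at h2
  filter_upwards [h2] with x hx
  have := congrArg ENNReal.toReal hx
  simpa using this.symm

lemma integral_eq_integral_inner_polarDensity {φ : R3 → R3} (hφ : Integrable φ μ.variation) :
    μ.integral φ (innerSL ℝ) = ∫ x, inner ℝ (φ x) (polarDensity μ x) ∂μ.variation := by
  have h := integral_withDensityᵥ (τ := μ.variation) (h := polarDensity μ) (f := φ) (innerSL ℝ)
    (integrable_polarDensity μ) (by rwa [variation_withDensityᵥ_polarDensity])
  rwa [variation_withDensityᵥ_polarDensity] at h

end EP2

/-! ### Decay of the kernel, and the adjoint identity -/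

namespace EP2

lemma kernel_neg (v z : R3) : kernel v (-z) = kernel v z := by
  simp [kernel, neg_div]

lemma kernel_sub_comm (v x y : R3) : kernel v (x - y) = kernel v (y - x) := by
  rw [← kernel_neg, neg_sub]

/-- The kernel decays like |y|⁻³. The power -1 suffices, to match the weight used for compactness.
-/
lemma exists_norm_kernel_sub_le {S Q : Set R3} (hS : IsClosed S) (hQ : IsCompact Q)
    (hQS : Q ⊆ Sᶜ) (v : R3) :
    ∃ D, 0 ≤ D ∧ ∀ x ∈ Q, ∀ y ∈ S, ‖kernel v (x - y)‖ ≤ D * (1 + ‖y‖)⁻¹ := by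
  obtain ⟨r, hr, h⟩ := exists_separation hS hQ hQS
  obtain ⟨R, hR0, hR⟩ := hQ.isBounded.exists_pos_norm_le
  refine ⟨4 * ‖v‖ * ((1 + R) / r ^ 3 + 1 / r ^ 2), by positivity, fun x hx y hy ↦ ?_⟩
  have hd := h x hx y hy
  have hd0 : 0 < ‖x - y‖ := hr.trans_le hd
  have hy' : 1 + ‖y‖ ≤ 1 + R + ‖x - y‖ := by
    have : ‖y‖ ≤ ‖x‖ + ‖x - y‖ := by
      have := norm_sub_le x (x - y)
      rwa [sub_sub_cancel] at this
    linarith [hR x hx]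
  rw [← div_eq_mul_inv, le_div_iff₀ (by positivity)]
  calc ‖kernel v (x - y)‖ * (1 + ‖y‖) ≤ 4 * ‖v‖ / ‖x - y‖ ^ 3 * (1 + R + ‖x - y‖) := by
        gcongr
        exact norm_kernel_le v hd0 le_rfl
    _ = 4 * ‖v‖ * ((1 + R) / ‖x - y‖ ^ 3 + 1 / ‖x - y‖ ^ 2) := by field_simp
    _ ≤ 4 * ‖v‖ * ((1 + R) / r ^ 3 + 1 / r ^ 2) := by gcongr

lemma exists_norm_kernel_sub_le_const {S Q : Set R3} (hS : IsClosed S) (hQ : IsCompact Q)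
    (hQS : Q ⊆ Sᶜ) (v : R3) :
    ∃ D, 0 ≤ D ∧ ∀ x ∈ Q, ∀ y ∈ S, ‖kernel v (x - y)‖ ≤ D := by
  obtain ⟨D, hD, h⟩ := exists_norm_kernel_sub_le hS hQ hQS v
  refine ⟨D, hD, fun x hx y hy ↦ (h x hx y hy).trans (mul_le_of_le_one_right hD ?_)⟩
  exact inv_le_one_of_one_le₀ (by linarith [norm_nonneg y])

variable {S Q : Set R3} (hS : IsClosed S) (hQ : IsCompact Q) (hQS : Q ⊆ Sᶜ)
  (ρ : Measure R3) [IsFiniteMeasure ρ] (hρ : ρ.support ⊆ Q) (v : R3)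

include hS hQ hQS hρ

lemma integrable_smul_kernel (Ψ : Lp ℝ 2 ρ) {y : R3} (hy : y ∈ S) :
    Integrable (fun x ↦ Ψ x • kernel v (y - x)) ρ := by
  obtain ⟨D, hD, h⟩ := exists_norm_kernel_sub_le_const hS hQ hQS v
  refine Integrable.smul_bdd ((Lp.memLp Ψ).integrable one_le_two)
    ((measurable_kernel v).comp (measurable_const.sub measurable_id)).aestronglyMeasurable
    (C := D) ?_
  filter_upwards [Filter.mem_of_superset Measure.support_mem_ae hρ] with x hx
  rw [kernel_sub_comm]
  exact h x hx y hy

/-- `A*Ψ` decays at infinity on `S`. -/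
lemma exists_norm_adjoint_le (Ψ : Lp ℝ 2 ρ) :
    ∃ D, 0 ≤ D ∧ ∀ y ∈ S, ‖adjoint ρ v Ψ y‖ ≤ D * (1 + ‖y‖)⁻¹ := by
  obtain ⟨D, hD, h⟩ := exists_norm_kernel_sub_le hS hQ hQS v
  refine ⟨‖magneticConstant / (4 * Real.pi)‖ * ((∫ x, ‖Ψ x‖ ∂ρ) * D), by positivity,
    fun y hy ↦ ?_⟩
  rw [adjoint, norm_smul, norm_neg, mul_assoc, mul_assoc, ← integral_mul_const]
  gcongr
  refine norm_integral_le_of_norm_le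
    (((Lp.memLp Ψ).integrable one_le_two).norm.mul_const _) ?_
  filter_upwards [Filter.mem_of_superset Measure.support_mem_ae hρ] with x hx
  rw [norm_smul, kernel_sub_comm]
  gcongr
  exact h x hx y hy

lemma continuousOn_adjoint (Ψ : Lp ℝ 2 ρ) : ContinuousOn (adjoint ρ v Ψ) S := by
  obtain ⟨D, hD, h⟩ := exists_norm_kernel_sub_le_const hS hQ hQS v
  have hae := Filter.mem_of_superset Measure.support_mem_ae hρ
  unfold adjoint
  refine (continuousOn_const (c := -(magneticConstant / (4 * Real.pi)))).smul
    (continuousOn_of_dominated (bound := fun x ↦ ‖Ψ x‖ * D)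
    (fun y hy ↦ (integrable_smul_kernel hS hQ hQS ρ hρ v Ψ hy).1) ?_
    (((Lp.memLp Ψ).integrable one_le_two).norm.mul_const _) ?_)
  · intro y hy
    filter_upwards [hae] with x hx
    rw [norm_smul, kernel_sub_comm]
    gcongr
    exact h x hx y hy
  · filter_upwards [hae] with x hx y hy
    have hne : y - x ≠ 0 := sub_ne_zero.2 fun hyx ↦ hQS hx (hyx ▸ hy)
    have hk : ContinuousAt (fun y ↦ kernel v (y - x)) y :=
      (continuousAt_kernel v hne).comp (f := fun y : R3 ↦ y - x) (by fun_prop)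
    exact (hk.const_smul (Ψ x)).continuousWithinAt

lemma integrable_adjoint (Ψ : Lp ℝ 2 ρ) (τ : Measure R3) [IsFiniteMeasure τ] (hτ : τ Sᶜ = 0) :
    Integrable (adjoint ρ v Ψ) τ := by
  obtain ⟨D, hD, h⟩ := exists_norm_adjoint_le hS hQ hQS ρ hρ v Ψ
  have hae : S ∈ ae τ := hτ
  have hm := (continuousOn_adjoint hS hQ hQS ρ hρ v Ψ).aestronglyMeasurable (μ := τ)
    hS.measurableSet
  rw [Measure.restrict_eq_self_of_ae_mem hae] at hm
  refine Integrable.of_bound hm D ?_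
  filter_upwards [hae] with y hy
  refine (h y hy).trans (mul_le_of_le_one_right hD ?_)
  exact inv_le_one_of_one_le₀ (by linarith [norm_nonneg y])

lemma integrable_adjoint_variation (Ψ : Lp ℝ 2 ρ) (μ : magnetizations S) :
    Integrable (adjoint ρ v Ψ) μ.1.variation :=
  integrable_adjoint hS hQ hQS ρ hρ v Ψ _
    ((Measure.support_subset_iff_measure_compl_eq_zero hS).1 μ.2)

/-- `A*` is the adjoint of the forward operator. -/
lemma inner_forward (Ψ : Lp ℝ 2 ρ) (μ : magnetizations S) :
    inner ℝ Ψ (forward hS hQ hQS ρ hρ v μ) = μ.1.integral (adjoint ρ v Ψ) (innerSL ℝ) := by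
  obtain ⟨D, hD, h⟩ := exists_norm_kernel_sub_le_const hS hQ hQS v
  have hQae : ∀ᵐ x ∂ρ, x ∈ Q := Filter.mem_of_superset Measure.support_mem_ae hρ
  have hSae : ∀ᵐ y ∂μ.1.variation, y ∈ S := Filter.mem_of_superset Measure.support_mem_ae μ.2
  have hΨ : Integrable Ψ ρ := (Lp.memLp Ψ).integrable one_le_two
  have hu := integrable_polarDensity μ.1
  set c := -(magneticConstant / (4 * Real.pi)) with hc
  -- Fubini is licensed by the bound D on the kernel over Q × S, which carries ρ ⊗ |μ|.
  have hint : Integrable (Function.uncurry fun x y ↦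
      Ψ x * inner ℝ (kernel v (x - y)) (polarDensity μ.1 y)) (ρ.prod μ.1.variation) := by
    refine ((hΨ.norm.mul_prod hu.norm).const_mul D).mono' ?_ ?_
    · refine AEStronglyMeasurable.mul hΨ.1.comp_fst (AEStronglyMeasurable.inner ?_ hu.1.comp_snd)
      exact ((measurable_kernel v).comp
        (measurable_fst.sub measurable_snd)).aestronglyMeasurable
    · filter_upwards [Measure.quasiMeasurePreserving_fst.ae hQae,
        Measure.quasiMeasurePreserving_snd.ae hSae] with p hp1 hp2
      simp only [Function.uncurry, norm_mul]
      calc ‖Ψ p.1‖ * ‖inner ℝ (kernel v (p.1 - p.2)) (polarDensity μ.1 p.2)‖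
          ≤ ‖Ψ p.1‖ * (D * ‖polarDensity μ.1 p.2‖) := by
            gcongr
            refine (norm_inner_le_norm _ _).trans ?_
            gcongr
            exact h _ hp1 _ hp2
        _ = _ := by ring
  rw [integral_eq_integral_inner_polarDensity _
    (integrable_adjoint_variation hS hQ hQS ρ hρ v Ψ μ), L2.inner_def]
  have h1 : ∫ x, inner ℝ (Ψ x) (forward hS hQ hQS ρ hρ v μ x) ∂ρ =
      ∫ x, c * ∫ y, Ψ x * inner ℝ (kernel v (x - y)) (polarDensity μ.1 y) ∂μ.1.variation ∂ρ := by
    refine integral_congr_ae ?_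
    filter_upwards [(memLp_fieldComponent hS hQ hQS ρ hρ v μ).coeFn_toLp, hQae] with x hx hxQ
    rw [forward, hx, fieldComponent, integral_eq_integral_inner_polarDensity, integral_const_mul,
      real_inner_eq_re_inner]
    · simp only [RCLike.inner_apply, conj_trivial, RCLike.re_to_real]
      ring
    · refine Integrable.of_bound ((measurable_kernel v).comp
        (measurable_const.sub measurable_id)).aestronglyMeasurable D ?_
      filter_upwards [hSae] with y hy using h x hxQ y hy
  have h2 : ∫ y, inner ℝ (adjoint ρ v Ψ y) (polarDensity μ.1 y) ∂μ.1.variation =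
      ∫ y, c * ∫ x, Ψ x * inner ℝ (kernel v (x - y)) (polarDensity μ.1 y) ∂ρ ∂μ.1.variation := by
    refine integral_congr_ae ?_
    filter_upwards [hSae] with y hy
    rw [adjoint, inner_smul_left, real_inner_comm, ← integral_inner
      (integrable_smul_kernel hS hQ hQS ρ hρ v Ψ hy)]
    simp only [conj_trivial, ← hc]
    congr 1
    refine integral_congr_ae (.of_forall fun x ↦ ?_)
    simp only [inner_smul_right, kernel_sub_comm v y x, real_inner_comm]
  rw [h1, h2, integral_const_mul, integral_const_mul, integral_integral_swap hint]

/-- Linearity of A is read off from its pairings with all Ψ, which are integrals of a fixed function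
against μ. -/
lemma forward_add (μ ν : magnetizations S) :
    forward hS hQ hQS ρ hρ v (μ + ν) =
      forward hS hQ hQS ρ hρ v μ + forward hS hQ hQS ρ hρ v ν := by
  refine ext_inner_left ℝ fun Ψ ↦ ?_
  rw [inner_add_right, inner_forward, inner_forward, inner_forward]
  exact VectorMeasure.integral_add_vectorMeasure
    (integrable_adjoint_variation hS hQ hQS ρ hρ v Ψ μ)
    (integrable_adjoint_variation hS hQ hQS ρ hρ v Ψ ν)

lemma forward_smul (c : ℝ) (μ : magnetizations S) :
    forward hS hQ hQS ρ hρ v (c • μ) = c • forward hS hQ hQS ρ hρ v μ := by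
  refine ext_inner_left ℝ fun Ψ ↦ ?_
  rw [inner_smul_right, inner_forward, inner_forward]
  exact VectorMeasure.integral_smul_vectorMeasure _ _

lemma forward_sub (μ ν : magnetizations S) :
    forward hS hQ hQS ρ hρ v (μ - ν) =
      forward hS hQ hQS ρ hρ v μ - forward hS hQ hQS ρ hρ v ν := by
  rw [eq_sub_iff_add_eq, ← forward_add, show μ - ν + ν = μ from sub_add_cancel μ ν]

end EP2

/-! ### Weighted vague compactness -/

namespace MeasureTheory

open Filter Topology
open scoped NNReal

section VagueCompactness

variable {E : Type*} [TopologicalSpace E] [MeasurableSpace E] [BorelSpace E] {w : E → ℝ}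

/-- ∫ Φ dπ = ∫ (Φ/w) d(wπ), and Φ/w is bounded and continuous, so weak convergence of the measures
wπ is enough. -/
lemma tendsto_integral_of_tendsto_withDensity {ι : Type*} {l : Filter ι} (hw : Continuous w)
    (hw0 : ∀ x, 0 < w x) {π : ι → Measure E} {σ : ι → FiniteMeasure E}
    (hσ : ∀ i, (σ i : Measure E) = (π i).withDensity fun x ↦ ENNReal.ofReal (w x))
    {σ₀ : FiniteMeasure E} (hl : Tendsto σ l (𝓝 σ₀)) {Φ : E → ℝ} (hΦ : Continuous Φ) {D : ℝ}
    (hD : ∀ x, |Φ x| ≤ D * w x) :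
    Tendsto (fun i ↦ ∫ x, Φ x ∂π i) l (𝓝 (∫ x, Φ x / w x ∂(σ₀ : Measure E))) := by
  have hb : ∀ x, ‖Φ x / w x‖ ≤ D := fun x ↦ by
    rw [norm_div, Real.norm_eq_abs, Real.norm_of_nonneg (hw0 x).le, div_le_iff₀ (hw0 x)]
    exact hD x
  let φ : BoundedContinuousFunction E ℝ :=
    BoundedContinuousFunction.ofNormedAddCommGroup (fun x ↦ Φ x / w x)
      (hΦ.div hw fun x ↦ (hw0 x).ne') D hb
  refine (FiniteMeasure.tendsto_iff_forall_integral_tendsto.1 hl φ).congr fun i ↦ ?_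
  rw [hσ, integral_withDensity_eq_integral_toReal_smul (by fun_prop) (by simp)]
  refine integral_congr_ae (.of_forall fun x ↦ ?_)
  have := (hw0 x).ne'
  simp only [ENNReal.toReal_ofReal (hw0 x).le, smul_eq_mul]
  change w x * (Φ x / w x) = Φ x
  field_simp

/-- Vague sequential compactness of bounded sets of measures, relative to a weight `w` that vanishes
at infinity. -/
lemma exists_vague_limit [T2Space E] [NormalSpace E] {C : ℝ} (hw : Continuous w)
    (hw0 : ∀ x, 0 < w x) (hw1 : ∀ x, w x ≤ 1)
    (hwK : ∀ ε > 0, IsCompact {x | ε ≤ w x}) (π : ℕ → Measure E) [∀ n, IsFiniteMeasure (π n)]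
    (hC : ∀ n, (π n).real univ ≤ C) :
    ∃ (l : Filter ℕ) (π₀ : Measure E), l.NeBot ∧ l ≤ atTop ∧ IsFiniteMeasure π₀ ∧
      (∀ c, (∀ᶠ n in l, (π n).real univ ≤ c) → π₀.real univ ≤ c) ∧
      ∀ Φ : E → ℝ, Continuous Φ → (∃ D, ∀ x, |Φ x| ≤ D * w x) →
        Tendsto (fun n ↦ ∫ x, Φ x ∂π n) l (𝓝 (∫ x, Φ x ∂π₀)) := by
  have hC0 : 0 ≤ C := measureReal_nonneg.trans (hC 0)
  have hπ : ∀ n, π n univ ≤ ENNReal.ofReal C := fun n ↦ by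
    rw [← ofReal_measureReal]; exact ENNReal.ofReal_le_ofReal (hC n)
  have hfin : ∀ n, IsFiniteMeasure ((π n).withDensity fun x ↦ ENNReal.ofReal (w x)) := fun n ↦
    isFiniteMeasure_withDensity (((lintegral_mono fun x ↦
      (ENNReal.ofReal_le_ofReal (hw1 x)).trans_eq ENNReal.ofReal_one).trans_lt
      (by simp)).ne)
  let σ : ℕ → FiniteMeasure E := fun n ↦ ⟨_, hfin n⟩
  -- Off K n the weight is below 1/(n+1), so wπ has mass at most C/(n+1) there: the weighted
  -- measures are uniformly tight.
  let K : ℕ → Set E := fun n ↦ {x | 1 / ((n : ℝ) + 1) ≤ w x}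
  let a : ℕ → ℝ≥0 := fun n ↦ Real.toNNReal (1 / ((n : ℝ) + 1) * C)
  have ha : Tendsto a atTop (𝓝 0) := by
    have := (tendsto_one_div_add_atTop_nhds_zero_nat (𝕜 := ℝ)).mul_const C
    rw [zero_mul] at this
    have h0 := (continuous_real_toNNReal.tendsto 0).comp this
    rw [Real.toNNReal_zero] at h0
    exact h0
  have hK := isCompact_setOfPred_finiteMeasure_mass_le_compl_isCompact_le (E := E) (u := a) (K := K)
    C.toNNReal ha (fun n ↦ hwK _ (by positivity)) (Or.inl inferInstance)
  have hmem : ∀ n, σ n ∈ {μ : FiniteMeasure E | μ.mass ≤ C.toNNReal ∧ ∀ n, μ (K n)ᶜ ≤ a n} := by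
    intro n
    refine ⟨?_, fun k ↦ ?_⟩
    · rw [← ENNReal.coe_le_coe, FiniteMeasure.ennreal_mass]
      change (π n).withDensity (fun x ↦ ENNReal.ofReal (w x)) univ ≤ _
      rw [withDensity_apply _ .univ, Measure.restrict_univ]
      calc ∫⁻ x, ENNReal.ofReal (w x) ∂π n ≤ ∫⁻ _, 1 ∂π n := lintegral_mono fun x ↦
            (ENNReal.ofReal_le_ofReal (hw1 x)).trans_eq ENNReal.ofReal_one
        _ = π n univ := by simp
        _ ≤ _ := hπ n
    · rw [← ENNReal.coe_le_coe, FiniteMeasure.ennreal_coeFn_eq_coeFn_toMeasure]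
      change (π n).withDensity (fun x ↦ ENNReal.ofReal (w x)) (K k)ᶜ ≤
        ENNReal.ofReal (1 / ((k : ℝ) + 1) * C)
      have hKm : MeasurableSet (K k)ᶜ := (hwK _ (by positivity)).isClosed.measurableSet.compl
      rw [withDensity_apply _ hKm]
      calc ∫⁻ x in (K k)ᶜ, ENNReal.ofReal (w x) ∂π n
          ≤ ∫⁻ x in (K k)ᶜ, ENNReal.ofReal (1 / ((k : ℝ) + 1)) ∂π n :=
            setLIntegral_mono measurable_const fun x hx ↦
              ENNReal.ofReal_le_ofReal (not_le.1 fun h ↦ hx h).le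
        _ = ENNReal.ofReal (1 / ((k : ℝ) + 1)) * π n (K k)ᶜ := by simp
        _ ≤ ENNReal.ofReal (1 / ((k : ℝ) + 1)) * ENNReal.ofReal C := by
            gcongr
            exact (measure_mono (subset_univ _)).trans (hπ n)
        _ = _ := (ENNReal.ofReal_mul (by positivity)).symm
  obtain ⟨σ₀, -, hσ₀⟩ := hK.exists_mapClusterPt (u := σ) (f := atTop)
    (tendsto_principal.2 (Eventually.of_forall hmem))
  obtain ⟨l, hl, hlσ⟩ := mapClusterPt_iff_ultrafilter.1 hσ₀
  have key := fun (Φ : E → ℝ) (hΦ : Continuous Φ) (D : ℝ) (hD : ∀ x, |Φ x| ≤ D * w x) ↦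
    tendsto_integral_of_tendsto_withDensity hw hw0 (π := π) (σ := σ) (fun _ ↦ rfl) hlσ hΦ hD
  have hmeas : Measurable fun x ↦ ENNReal.ofReal (1 / w x) := by fun_prop
  have hmass : ∀ c, (∀ᶠ n in (l : Filter ℕ), (π n).real univ ≤ c) →
      (∫⁻ x, ENNReal.ofReal (1 / w x) ∂(σ₀ : Measure E)) ≤ ENNReal.ofReal c := by
    intro c hc
    -- 1/w may be unbounded, so weak convergence is applied to the truncations min(1, Mw)/w, which
    -- increase to it. Each one integrates against wπ to at most the mass of π.
    have hmono : ∀ x, ENNReal.ofReal (1 / w x) =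
        ⨆ M : ℕ, ENNReal.ofReal (min 1 (M * w x) / w x) := by
      intro x
      have hx := hw0 x
      refine le_antisymm ?_ (iSup_le fun M ↦ ENNReal.ofReal_le_ofReal ?_)
      · obtain ⟨M, hM⟩ := exists_nat_ge (1 / w x)
        refine le_iSup_of_le M (ENNReal.ofReal_le_ofReal ?_)
        rw [min_eq_left ((div_le_iff₀ hx).1 hM)]
      · gcongr; exact min_le_left _ _
    simp_rw [hmono]
    rw [lintegral_iSup (fun M ↦ by fun_prop) fun M N hMN x ↦ ENNReal.ofReal_le_ofReal (by
      have := (hw0 x).le; gcongr)]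
    refine iSup_le fun M ↦ ?_
    have hnn : ∀ x, 0 ≤ min 1 (M * w x) := fun x ↦
      le_min zero_le_one (mul_nonneg M.cast_nonneg (hw0 x).le)
    have hle : ∀ x, |min 1 (M * w x)| ≤ M * w x := fun x ↦ by
      rw [abs_of_nonneg (hnn x)]; exact min_le_right _ _
    rw [← ofReal_integral_eq_lintegral_ofReal]
    · refine ENNReal.ofReal_le_ofReal (le_of_tendsto (key _ (by fun_prop) M hle) ?_)
      filter_upwards [hc] with n hn
      refine le_trans ?_ hn
      have h1 : ∫ _, (1 : ℝ) ∂π n = (π n).real univ := by simp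
      rw [← h1]
      refine integral_mono_of_nonneg (.of_forall hnn) (integrable_const _)
        (.of_forall fun x ↦ min_le_left _ _)
    · refine Integrable.of_bound (Continuous.aestronglyMeasurable
        (by fun_prop (disch := exact fun x ↦ (hw0 x).ne'))) (M : ℝ) (.of_forall fun x ↦ ?_)
      rw [norm_div, Real.norm_eq_abs, Real.norm_of_nonneg (hw0 x).le, div_le_iff₀ (hw0 x)]
      exact hle x
    · exact .of_forall fun x ↦ div_nonneg (hnn x) (hw0 x).le
  refine ⟨l, (σ₀ : Measure E).withDensity fun x ↦ ENNReal.ofReal (1 / w x), l.neBot, hl, ?_, ?_, ?_⟩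
  · exact isFiniteMeasure_withDensity
      ((hmass C (.of_forall hC)).trans_lt ENNReal.ofReal_lt_top).ne
  · intro c hc
    obtain ⟨n, hn⟩ := hc.exists
    have hc0 : 0 ≤ c := measureReal_nonneg.trans hn
    refine ENNReal.toReal_le_of_le_ofReal hc0 ?_
    rw [withDensity_apply _ .univ, Measure.restrict_univ]
    exact hmass c hc
  · rintro Φ hΦ ⟨D, hD⟩
    rw [integral_withDensity_eq_integral_toReal_smul hmeas (by simp)]
    convert key Φ hΦ D hD using 4 with x
    rw [ENNReal.toReal_ofReal (one_div_nonneg.2 (hw0 x).le), smul_eq_mul]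
    ring

end VagueCompactness

end MeasureTheory

/-! ### Dipole measures and existence of a solution -/

namespace EP2

open Filter Topology

/-- The space of point dipoles located in `S`, with moments of norm at most one. -/
abbrev DipoleSpace (S : Set R3) : Type := S × Metric.closedBall (0 : R3) 1

/-- A weight on `DipoleSpace S` which vanishes at infinity. -/
def dipoleWeight {S : Set R3} (p : DipoleSpace S) : ℝ := (1 + ‖(p.1 : R3)‖)⁻¹

lemma dipoleWeight_pos {S : Set R3} (p : DipoleSpace S) : 0 < dipoleWeight p := by
  unfold dipoleWeight; positivity

lemma dipoleWeight_le_one {S : Set R3} (p : DipoleSpace S) : dipoleWeight p ≤ 1 :=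
  inv_le_one_of_one_le₀ (by linarith [norm_nonneg (p.1 : R3)])

lemma continuous_dipoleWeight {S : Set R3} : Continuous (dipoleWeight (S := S)) := by
  unfold dipoleWeight
  exact Continuous.inv₀ (by fun_prop) fun p ↦ by positivity

lemma isCompact_le_dipoleWeight {S : Set R3} (hS : IsClosed S) {ε : ℝ} (hε : 0 < ε) :
    IsCompact {p : DipoleSpace S | ε ≤ dipoleWeight p} := by
  have : CompactSpace (Metric.closedBall (0 : R3) 1) :=
    isCompact_iff_compactSpace.1 (isCompact_closedBall _ _)
  have hK : IsCompact (((↑) : S → R3) ⁻¹' Metric.closedBall 0 ε⁻¹) :=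
    hS.isClosedEmbedding_subtypeVal.isCompact_preimage (isCompact_closedBall _ _)
  refine (hK.prod (isCompact_univ (X := Metric.closedBall (0 : R3) 1))).of_isClosed_subset
    (isClosed_le continuous_const continuous_dipoleWeight) fun p hp ↦ ⟨?_, mem_univ _⟩
  have h1 : ε ≤ (1 + ‖(p.1 : R3)‖)⁻¹ := hp
  have h2 := (le_inv_comm₀ hε (by positivity)).1 h1
  simp only [mem_preimage, mem_closedBall_zero_iff]
  linarith

variable {S Q : Set R3} (hS : IsClosed S) (hQ : IsCompact Q) (hQS : Q ⊆ Sᶜ)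
  (ρ : Measure R3) [IsFiniteMeasure ρ] (hρ : ρ.support ⊆ Q) (v : R3)

/-- The pairing of `A*Ψ` with a point dipole. -/
def dipolePairing (S : Set R3) (Ψ : Lp ℝ 2 ρ) (p : DipoleSpace S) : ℝ :=
  inner ℝ (adjoint ρ v Ψ p.1) (p.2 : R3)

include hS hQ hQS hρ

lemma continuous_dipolePairing (Ψ : Lp ℝ 2 ρ) : Continuous (dipolePairing ρ v S Ψ) := by
  have h := continuousOn_iff_continuous_domRestrict.1 (continuousOn_adjoint hS hQ hQS ρ hρ v Ψ)
  exact Continuous.inner (h.comp continuous_fst) (continuous_subtype_val.comp continuous_snd)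

lemma exists_abs_dipolePairing_le (Ψ : Lp ℝ 2 ρ) :
    ∃ D, ∀ p, |dipolePairing ρ v S Ψ p| ≤ D * dipoleWeight p := by
  obtain ⟨D, hD, h⟩ := exists_norm_adjoint_le hS hQ hQS ρ hρ v Ψ
  refine ⟨D, fun p ↦ (abs_real_inner_le_norm _ _).trans ?_⟩
  have h2 : ‖(p.2 : R3)‖ ≤ 1 := mem_closedBall_zero_iff.1 p.2.2
  exact (mul_le_of_le_one_right (norm_nonneg _) h2).trans (h _ p.1.2)

/-- Every magnetization is represented by a measure on the space of dipoles. -/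
lemma exists_dipole_measure (μ : magnetizations S) :
    ∃ π : Measure (DipoleSpace S), IsFiniteMeasure π ∧ π.real univ ≤ tvNorm μ.1 ∧
      ∀ Ψ : Lp ℝ 2 ρ, inner ℝ Ψ (forward hS hQ hQS ρ hρ v μ) = ∫ p, dipolePairing ρ v S Ψ p ∂π := by
  classical
  have hSm := hS.measurableSet
  have hSae : S ∈ ae μ.1.variation := Filter.mem_of_superset Measure.support_mem_ae μ.2
  -- The polar density has norm one only a.e.; this version takes values in the unit ball
  -- everywhere.
  let u : R3 → R3 := fun y ↦ if ‖polarDensity μ.1 y‖ ≤ 1 then polarDensity μ.1 y else 0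
  have hu : Measurable u := Measurable.ite
    (measurableSet_le (measurable_polarDensity μ.1).norm measurable_const)
    (measurable_polarDensity μ.1) measurable_const
  have hu1 : ∀ y, u y ∈ Metric.closedBall (0 : R3) 1 := fun y ↦ by
    rw [mem_closedBall_zero_iff]
    by_cases h : ‖polarDensity μ.1 y‖ ≤ 1 <;> simp [u, h]
  have huae : ∀ᵐ y ∂μ.1.variation, u y = polarDensity μ.1 y := by
    filter_upwards [norm_polarDensity μ.1] with y hy using if_pos hy.le
  let T : S → DipoleSpace S := fun y ↦ (y, ⟨u y, hu1 y⟩)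
  have hT : Measurable T := measurable_id.prodMk ((hu.comp measurable_subtype_coe).subtype_mk)
  have hle : (μ.1.variation.comap ((↑) : S → R3)) univ ≤ μ.1.variation univ := by
    rw [(MeasurableEmbedding.subtype_coe hSm).comap_apply]
    exact measure_mono (subset_univ _)
  refine ⟨(μ.1.variation.comap (↑)).map T, ⟨?_⟩, ?_, fun Ψ ↦ ?_⟩
  · rw [Measure.map_apply hT .univ, preimage_univ]
    exact hle.trans_lt (measure_lt_top _ _)
  · rw [tvNorm, measureReal_def, measureReal_def, Measure.map_apply hT .univ, preimage_univ]
    exact ENNReal.toReal_mono (measure_ne_top _ _) hle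
  · rw [inner_forward, integral_eq_integral_inner_polarDensity _
      (integrable_adjoint_variation hS hQ hQS ρ hρ v Ψ μ), integral_map hT.aemeasurable
      (continuous_dipolePairing hS hQ hQS ρ hρ v Ψ).aestronglyMeasurable]
    refine Eq.trans ?_ (integral_subtype_comap hSm
      fun y ↦ inner ℝ (adjoint ρ v Ψ y) (u y)).symm
    rw [Measure.restrict_eq_self_of_ae_mem hSae]
    refine integral_congr_ae ?_
    filter_upwards [huae] with y hy
    rw [hy]

/-- Every finite measure on the space of dipoles represents a magnetization. -/
lemma exists_magnetization (π : Measure (DipoleSpace S)) [IsFiniteMeasure π] :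
    ∃ μ : magnetizations S, tvNorm μ.1 ≤ π.real univ ∧
      ∀ Ψ : Lp ℝ 2 ρ, inner ℝ Ψ (forward hS hQ hQS ρ hρ v μ) = ∫ p, dipolePairing ρ v S Ψ p ∂π := by
  -- The magnetization is the moment density h dπ pushed forward to the locations; |h| ≤ 1 bounds
  -- its variation by the mass of π.
  let h : DipoleSpace S → R3 := fun p ↦ p.2
  have hhc : Continuous h := continuous_subtype_val.comp continuous_snd
  have hh1 : ∀ p, ‖h p‖ ≤ 1 := fun p ↦ mem_closedBall_zero_iff.1 p.2.2
  have hh : Integrable h π := Integrable.of_bound hhc.aestronglyMeasurable 1 (.of_forall hh1)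
  let e : DipoleSpace S → R3 := fun p ↦ p.1
  have he : Measurable e := (continuous_subtype_val.comp continuous_fst).measurable
  have hvar : (π.withDensityᵥ h).variation ≤ π := by
    rw [Measure.variation_withDensityᵥ hh]
    conv_rhs => rw [← withDensity_one (μ := π)]
    refine withDensity_mono (.of_forall fun p ↦ ?_)
    have := enorm_le_iff_norm_le.2 ((hh1 p).trans_eq (norm_one (α := ℝ)).symm)
    simpa using this
  have hvar2 : ((π.withDensityᵥ h).map e).variation ≤ π.map e :=
    VectorMeasure.variation_map_le.trans (Measure.map_mono hvar he)
  have hSnull : π.map e Sᶜ = 0 := by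
    rw [Measure.map_apply he hS.measurableSet.compl]
    convert measure_empty (μ := π)
    ext p
    simp [e]
  refine ⟨⟨(π.withDensityᵥ h).map e, ?_⟩, ?_, fun Ψ ↦ ?_⟩
  · exact (Measure.support_mono hvar2).trans
      ((Measure.support_subset_iff_measure_compl_eq_zero hS).2 hSnull)
  · rw [tvNorm, measureReal_def, measureReal_def]
    refine ENNReal.toReal_mono (measure_ne_top _ _) ((hvar2 univ).trans_eq ?_)
    rw [Measure.map_apply he .univ, preimage_univ]
  · rw [inner_forward]
    have : IsFiniteMeasure (π.withDensityᵥ h).variation := isFiniteMeasure_of_le _ hvar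
    have hc : Continuous fun p : DipoleSpace S ↦ adjoint ρ v Ψ p.1 :=
      (continuousOn_iff_continuous_domRestrict.1
        (continuousOn_adjoint hS hQ hQS ρ hρ v Ψ)).comp continuous_fst
    have hint : (π.withDensityᵥ h).Integrable (adjoint ρ v Ψ ∘ e) := by
      obtain ⟨D, hD, hb⟩ := exists_norm_adjoint_le hS hQ hQS ρ hρ v Ψ
      refine Integrable.of_bound hc.aestronglyMeasurable D (.of_forall fun p ↦ ?_)
      exact (hb _ p.1.2).trans (mul_le_of_le_one_right hD (dipoleWeight_le_one p))
    change ((π.withDensityᵥ h).map e).integral _ _ = _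
    rw [VectorMeasure.integral_map he _ hint]
    · exact integral_withDensityᵥ _ hh hint
    · exact (integrable_adjoint hS hQ hQS ρ hρ v Ψ _ (le_antisymm
        ((Measure.map_mono hvar he _).trans_eq hSnull) zero_le)).1

/-- The extremal problem has a solution. -/
lemma exists_isSolution (f : Lp ℝ 2 ρ) {lam : ℝ} (hlam : 0 < lam) :
    ∃ μ : magnetizations S, IsSolution hS hQ hQS ρ hρ v f lam μ := by
  set J := functional hS hQ hQS ρ hρ v f lam with hJ
  have htv : ∀ μ : magnetizations S, 0 ≤ tvNorm μ.1 := fun μ ↦ measureReal_nonneg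
  have hJ0 : ∀ μ, 0 ≤ J μ := fun μ ↦ by
    have := htv μ
    simp only [hJ, functional]; positivity
  have hbdd : BddBelow (range J) := ⟨0, by rintro _ ⟨μ, rfl⟩; exact hJ0 μ⟩
  set m := sInf (range J) with hm
  have hmle : ∀ μ, m ≤ J μ := fun μ ↦ csInf_le hbdd ⟨μ, rfl⟩
  have hex : ∀ n : ℕ, ∃ μ, J μ < m + 1 / ((n : ℝ) + 1) := fun n ↦ by
    obtain ⟨_, ⟨μ, rfl⟩, h⟩ := exists_lt_of_csInf_lt (range_nonempty J)
      (lt_add_of_pos_right m (by positivity : 0 < 1 / ((n : ℝ) + 1)))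
    exact ⟨μ, h⟩
  choose μ hμ using hex
  choose π hπf hπtv hπ using fun n ↦ exists_dipole_measure hS hQ hQS ρ hρ v (μ n)
  have hbound : ∀ n, (π n).real univ ≤ (m + 1) / lam := fun n ↦ by
    refine (hπtv n).trans ((le_div_iff₀ hlam).2 ?_)
    have h1 : 1 / ((n : ℝ) + 1) ≤ 1 := by
      rw [div_le_one (by positivity)]; linarith [(n.cast_nonneg : (0 : ℝ) ≤ n)]
    have h2 := hμ n
    simp only [hJ, functional] at h2
    nlinarith [sq_nonneg ‖f - forward hS hQ hQS ρ hρ v (μ n)‖]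
  obtain ⟨l, π₀, hlne, hl, hπ₀, hmass, hlim⟩ := exists_vague_limit continuous_dipoleWeight
    dipoleWeight_pos dipoleWeight_le_one (fun ε hε ↦ isCompact_le_dipoleWeight hS hε) π hbound
  obtain ⟨μ₀, hμ₀tv, hμ₀⟩ := exists_magnetization hS hQ hQS ρ hρ v π₀
  refine ⟨μ₀, fun ν ↦ le_trans ?_ (hmle ν)⟩
  set r := f - forward hS hQ hQS ρ hρ v μ₀ with hr
  have hconv : Tendsto (fun n ↦ inner ℝ r (f - forward hS hQ hQS ρ hρ v (μ n))) l
      (𝓝 (‖r‖ ^ 2)) := by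
    have h1 := hlim (dipolePairing ρ v S r) (continuous_dipolePairing hS hQ hQS ρ hρ v r)
      (exists_abs_dipolePairing_le hS hQ hQS ρ hρ v r)
    simp_rw [← hπ, ← hμ₀] at h1
    have h2 := h1.const_sub (inner ℝ r f)
    simp_rw [← inner_sub_right] at h2
    rwa [← hr, real_inner_self_eq_norm_sq] at h2
  refine le_of_forall_pos_le_add fun ε hε ↦ ?_
  have hsmall : ∀ᶠ n : ℕ in l, 1 / ((n : ℝ) + 1) < ε / 3 :=
    hl ((tendsto_one_div_add_atTop_nhds_zero_nat (𝕜 := ℝ)).eventually_lt_const (by positivity))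
  -- With rₙ = f - Aμₙ, the bound 2⟨r, rₙ⟩ ≤ ‖r‖² + ‖rₙ‖² gives ‖rₙ‖² ≥ ‖r‖² - 2ε/3. The last ε/3 is
  -- the defect of μₙ as a minimizer.
  have hle : ∀ᶠ n in l, (π n).real univ ≤ (m + ε - ‖r‖ ^ 2) / lam := by
    filter_upwards [hsmall, hconv.eventually_const_lt
      (show ‖r‖ ^ 2 - ε / 3 < ‖r‖ ^ 2 by linarith)] with n hn1 hn2
    refine (hπtv n).trans ((le_div_iff₀ hlam).2 ?_)
    have h2 := hμ n
    simp only [hJ, functional] at h2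
    have h3 := real_inner_le_norm r (f - forward hS hQ hQS ρ hρ v (μ n))
    nlinarith [sq_nonneg (‖r‖ - ‖f - forward hS hQ hQS ρ hρ v (μ n)‖)]
  have h4 := (le_div_iff₀ hlam).1 (hμ₀tv.trans (hmass _ hle))
  change ‖r‖ ^ 2 + lam * tvNorm μ₀.1 ≤ m + ε
  linarith

end EP2

/-! ### Duality and optimality conditions -/

namespace EP2

open Filter Topology

lemma tvNorm_add_le (μ ν : VectorMeasure R3 R3) : tvNorm (μ + ν) ≤ tvNorm μ + tvNorm ν := by
  simp only [tvNorm, measureReal_def]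
  rw [← ENNReal.toReal_add (measure_ne_top _ _) (measure_ne_top _ _)]
  exact ENNReal.toReal_mono (by finiteness) (VectorMeasure.variation_add_le univ)

lemma tvNorm_smul (c : ℝ) (μ : VectorMeasure R3 R3) : tvNorm (c • μ) = |c| * tvNorm μ := by
  simp [tvNorm, measureReal_def, VectorMeasure.variation_smul]

lemma tvNorm_dirac (x e : R3) : tvNorm (VectorMeasure.dirac x e) = ‖e‖ := by
  simp [tvNorm, measureReal_def]

variable {S Q : Set R3} (hS : IsClosed S) (hQ : IsCompact Q) (hQS : Q ⊆ Sᶜ)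
  (ρ : Measure R3) [IsFiniteMeasure ρ] (hρ : ρ.support ⊆ Q) (v : R3)

lemma functional_eq (f : Lp ℝ 2 ρ) (lam : ℝ) (μ ν : magnetizations S) :
    functional hS hQ hQS ρ hρ v f lam ν = functional hS hQ hQS ρ hρ v f lam μ +
      ‖forward hS hQ hQS ρ hρ v (ν - μ)‖ ^ 2 -
      2 * (inner ℝ (f - forward hS hQ hQS ρ hρ v μ) (forward hS hQ hQS ρ hρ v ν) -
        inner ℝ (f - forward hS hQ hQS ρ hρ v μ) (forward hS hQ hQS ρ hρ v μ)) +
      lam * (tvNorm ν.1 - tvNorm μ.1) := by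
  rw [← inner_sub_right, forward_sub]
  have := norm_sub_sq_real (f - forward hS hQ hQS ρ hρ v μ)
    (forward hS hQ hQS ρ hρ v ν - forward hS hQ hQS ρ hρ v μ)
  rw [sub_sub_sub_cancel_right] at this
  unfold functional
  rw [this]
  ring

/-- Duality between the total variation norm and the sup norm of `A*Ψ` on `S`. -/
lemma forall_inner_forward_le_iff (Ψ : Lp ℝ 2 ρ) {M : ℝ} (hM : 0 ≤ M) :
    (∀ ν : magnetizations S, inner ℝ Ψ (forward hS hQ hQS ρ hρ v ν) ≤ M * tvNorm ν.1) ↔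
      ∀ x ∈ S, ‖adjoint ρ v Ψ x‖ ≤ M := by
  constructor
  · intro h x hx
    set e := adjoint ρ v Ψ x with he
    -- The point dipole at x with moment e = A*Ψ(x) turns the hypothesis into |e|² ≤ M|e|.
    have hmem : VectorMeasure.dirac x e ∈ magnetizations S := by
      refine (Measure.support_subset_iff_measure_compl_eq_zero hS).2 ?_
      simp [hS.measurableSet.compl, hx]
    have h1 := h ⟨_, hmem⟩
    rw [inner_forward] at h1
    rw [VectorMeasure.integral_dirac, tvNorm_dirac, ← he] at h1
    replace h1 : inner ℝ e e ≤ M * ‖e‖ := h1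
    rw [real_inner_self_eq_norm_sq] at h1
    by_contra! hlt
    nlinarith
  · intro h ν
    have hSae : ∀ᵐ y ∂ν.1.variation, y ∈ S := Filter.mem_of_superset Measure.support_mem_ae ν.2
    have hi := integrable_adjoint_variation hS hQ hQS ρ hρ v Ψ ν
    rw [inner_forward, integral_eq_integral_inner_polarDensity _ hi]
    calc ∫ x, inner ℝ (adjoint ρ v Ψ x) (polarDensity ν.1 x) ∂ν.1.variation
        ≤ ∫ _, M ∂ν.1.variation := by
          refine integral_mono_ae (integrable_bilin_of_integrable_withDensityᵥ (innerSL ℝ)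
            (integrable_polarDensity ν.1) (by rwa [variation_withDensityᵥ_polarDensity]))
            (integrable_const _) ?_
          filter_upwards [hSae, norm_polarDensity ν.1] with x hx hu
          refine (real_inner_le_norm _ _).trans ?_
          rw [hu, mul_one]
          exact h x hx
      _ = M * tvNorm ν.1 := by simp [tvNorm, mul_comm]

/-- Equality in the duality between the total variation norm and the sup norm of `A*Ψ` on `S`. -/
lemma inner_forward_eq_iff (Ψ : Lp ℝ 2 ρ) {M : ℝ} (hM : 0 ≤ M)
    (h : ∀ x ∈ S, ‖adjoint ρ v Ψ x‖ ≤ M) (μ : magnetizations S) :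
    inner ℝ Ψ (forward hS hQ hQS ρ hρ v μ) = M * tvNorm μ.1 ↔
      ∀ᵐ x ∂μ.1.variation, adjoint ρ v Ψ x = M • polarDensity μ.1 x := by
  have hSae : ∀ᵐ y ∂μ.1.variation, y ∈ S := Filter.mem_of_superset Measure.support_mem_ae μ.2
  have hi := integrable_adjoint_variation hS hQ hQS ρ hρ v Ψ μ
  have hi2 : Integrable (fun x ↦ inner ℝ (adjoint ρ v Ψ x) (polarDensity μ.1 x)) μ.1.variation :=
    integrable_bilin_of_integrable_withDensityᵥ (innerSL ℝ)
      (integrable_polarDensity μ.1) (by rwa [variation_withDensityᵥ_polarDensity])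
  have hM' : M * tvNorm μ.1 = ∫ _, M ∂μ.1.variation := by simp [tvNorm, mul_comm]
  rw [inner_forward, integral_eq_integral_inner_polarDensity _ hi, hM', eq_comm, ← sub_eq_zero,
    ← integral_sub (integrable_const _) hi2,
    integral_eq_zero_iff_of_nonneg_ae (f := fun x ↦ M - _) ?_ ((integrable_const _).sub hi2)]
  · refine eventually_congr ?_
    filter_upwards [hSae, norm_polarDensity μ.1] with x hx hu
    have hGx := h x hx
    set G := adjoint ρ v Ψ x
    set u := polarDensity μ.1 x
    simp only [Pi.zero_apply, sub_eq_zero]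
    constructor
    · intro heq
      -- Equality in Cauchy–Schwarz: |u| = 1, |G| ≤ M and G·u = M give |G - Mu|² = |G|² - M² ≤ 0.
      have h1 : ‖G - M • u‖ ^ 2 = ‖G‖ ^ 2 - 2 * (M * inner ℝ G u) + M ^ 2 := by
        rw [norm_sub_sq_real, inner_smul_right, norm_smul, hu, mul_one, Real.norm_eq_abs, sq_abs]
      have h2 : ‖G - M • u‖ ^ 2 ≤ 0 := by
        rw [h1, ← heq]
        nlinarith [norm_nonneg G]
      have h3 : ‖G - M • u‖ = 0 := by
        nlinarith [norm_nonneg (G - M • u), sq_nonneg ‖G - M • u‖]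
      exact sub_eq_zero.1 (norm_eq_zero.1 h3)
    · intro heq
      rw [heq, inner_smul_left, real_inner_self_eq_norm_sq, hu]
      simp
  · filter_upwards [hSae, norm_polarDensity μ.1] with x hx hu
    have := real_inner_le_norm (adjoint ρ v Ψ x) (polarDensity μ.1 x)
    rw [hu, mul_one] at this
    exact sub_nonneg.2 (this.trans (h x hx))

/-- The optimality conditions in terms of the total variation norm. -/
lemma isSolution_iff_inner (f : Lp ℝ 2 ρ) {lam : ℝ} (hlam : 0 ≤ lam) (μ : magnetizations S) :
    IsSolution hS hQ hQS ρ hρ v f lam μ ↔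
      (∀ ν : magnetizations S, inner ℝ (f - forward hS hQ hQS ρ hρ v μ)
        (forward hS hQ hQS ρ hρ v ν) ≤ lam / 2 * tvNorm ν.1) ∧
      inner ℝ (f - forward hS hQ hQS ρ hρ v μ) (forward hS hQ hQS ρ hρ v μ) =
        lam / 2 * tvNorm μ.1 := by
  constructor
  · intro h
    have limit : ∀ a b : ℝ, (∀ t : ℝ, 0 < t → t ≤ 1 → 0 ≤ t ^ 2 * a + t * b) → 0 ≤ b := by
      intro a b hab
      have h1 : Tendsto (fun t : ℝ ↦ t * a + b) (𝓝[>] 0) (𝓝 b) := by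
        have : Tendsto (fun t : ℝ ↦ t * a + b) (𝓝 0) (𝓝 (0 * a + b)) :=
          Continuous.tendsto (by fun_prop) 0
        rw [zero_mul, zero_add] at this
        exact this.mono_left nhdsWithin_le_nhds
      refine ge_of_tendsto h1 ?_
      filter_upwards [Ioc_mem_nhdsGT one_pos] with t ht
      have := hab t ht.1 ht.2
      have h2 : 0 ≤ t * (t * a + b) := by linear_combination this
      exact nonneg_of_mul_nonneg_right h2 ht.1
    -- One-sided derivative at μ in direction ν, where d bounds the growth rate of the total
    -- variation.
    have hvar : ∀ (ν : magnetizations S) (d : ℝ),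
        (∀ t : ℝ, 0 < t → t ≤ 1 → tvNorm (μ + t • ν).1 ≤ tvNorm μ.1 + t * d) →
        2 * inner ℝ (f - forward hS hQ hQS ρ hρ v μ) (forward hS hQ hQS ρ hρ v ν) ≤ lam * d := by
      intro ν d hd
      rw [← sub_nonneg]
      refine limit (‖forward hS hQ hQS ρ hρ v ν‖ ^ 2) _ fun t ht ht1 ↦ ?_
      have h1 := h (μ + t • ν)
      rw [functional_eq hS hQ hQS ρ hρ v f lam μ (μ + t • ν),
        show μ + t • ν - μ = t • ν from
          Subtype.ext (add_sub_cancel_left μ.1 (t • ν.1)), forward_add, forward_smul,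
        inner_add_right, inner_smul_right, norm_smul, mul_pow, Real.norm_eq_abs, sq_abs] at h1
      have h2 := mul_le_mul_of_nonneg_left (hd t ht ht1) hlam
      linarith
    have hle : ∀ ν : magnetizations S, inner ℝ (f - forward hS hQ hQS ρ hρ v μ)
        (forward hS hQ hQS ρ hρ v ν) ≤ lam / 2 * tvNorm ν.1 := by
      intro ν
      have := hvar ν (tvNorm ν.1) fun t ht _ ↦ by
        refine (tvNorm_add_le _ _).trans_eq ?_
        rw [← abs_of_pos ht, ← tvNorm_smul, abs_of_pos ht]
        rfl
      linarith
    refine ⟨hle, le_antisymm (hle μ) ?_⟩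
    -- Shrinking μ lowers its norm at the exact rate ‖μ‖ as long as t ≤ 1, which yields the reverse
    -- inequality.
    have := hvar ((-1 : ℝ) • μ) (-tvNorm μ.1) fun t ht ht1 ↦ by
      have h1 : (μ + t • (-1 : ℝ) • μ).1 = (1 - t) • μ.1 := by
        change μ.1 + t • (-1 : ℝ) • μ.1 = (1 - t) • μ.1
        module
      rw [h1, tvNorm_smul, abs_of_nonneg (by linarith)]
      linarith
    rw [forward_smul, inner_smul_right] at this
    linarith
  · rintro ⟨h1, h2⟩ ν
    rw [functional_eq hS hQ hQS ρ hρ v f lam μ ν]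
    nlinarith [h1 ν, sq_nonneg ‖forward hS hQ hQS ρ hρ v (ν - μ)‖]

/-- By the optimality conditions at μ, the other terms of the expansion add up to something
nonnegative, so the quadratic term must vanish. -/
lemma forward_eq_of_isSolution {f : Lp ℝ 2 ρ} {lam : ℝ} (hlam : 0 ≤ lam) {μ μ' : magnetizations S}
    (h : IsSolution hS hQ hQS ρ hρ v f lam μ) (h' : IsSolution hS hQ hQS ρ hρ v f lam μ') :
    forward hS hQ hQS ρ hρ v μ' = forward hS hQ hQS ρ hρ v μ := by
  have h0 := h' μ
  obtain ⟨h1, h2⟩ := (isSolution_iff_inner hS hQ hQS ρ hρ v f hlam μ).1 h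
  rw [functional_eq hS hQ hQS ρ hρ v f lam μ μ'] at h0
  have h3 : ‖forward hS hQ hQS ρ hρ v (μ' - μ)‖ ^ 2 ≤ 0 := by linarith [h1 μ']
  rw [forward_sub] at h3
  rw [← sub_eq_zero, ← norm_eq_zero]
  exact pow_eq_zero_iff two_ne_zero |>.1 (le_antisymm h3 (sq_nonneg _))

lemma isSolution_iff_adjoint (f : Lp ℝ 2 ρ) {lam : ℝ} (hlam : 0 ≤ lam) (μ : magnetizations S) :
    IsSolution hS hQ hQS ρ hρ v f lam μ ↔
      (∀ᵐ x ∂μ.1.variation, adjoint ρ v (f - forward hS hQ hQS ρ hρ v μ) x =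
        (lam / 2) • polarDensity μ.1 x) ∧
      ∀ x ∈ S, ‖adjoint ρ v (f - forward hS hQ hQS ρ hρ v μ) x‖ ≤ lam / 2 := by
  have hM : 0 ≤ lam / 2 := by positivity
  rw [isSolution_iff_inner hS hQ hQS ρ hρ v f hlam μ, forall_inner_forward_le_iff _ _ _ _ _ _ _ hM,
    and_comm]
  exact and_congr_left fun h ↦ inner_forward_eq_iff hS hQ hQS ρ hρ v _ hM h μ

/-- A measure whose polar density is prescribed on its support splits into a part with a density
with respect to a given measure with the same polar density and a singular part. -/
lemma exists_withDensity_add_singular {G : R3 → R3} {μ μ' : VectorMeasure R3 R3}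
    (hμ : polarDensity μ =ᵐ[μ.variation] G) (hμ' : polarDensity μ' =ᵐ[μ'.variation] G) :
    ∃ (g : R3 → ℝ) (ν : Measure R3), (∀ x, 0 ≤ g x) ∧ Integrable g μ.variation ∧
      ν ≤ μ'.variation ∧ ν ⟂ₘ μ.variation ∧
      μ' = μ.withDensity g (ContinuousLinearMap.lsmul ℝ ℝ) + ν.withDensityᵥ G := by
  have : μ'.variation.HaveLebesgueDecomposition μ.variation :=
    Measure.haveLebesgueDecomposition_of_sigmaFinite _ _
  set ν := μ'.variation.singularPart μ.variation with hν
  set d := μ'.variation.rnDeriv μ.variation with hd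
  have hdec : μ'.variation = ν + μ.variation.withDensity d :=
    Measure.haveLebesgueDecomposition_add _ _
  have hνle : ν ≤ μ'.variation := Measure.singularPart_le _ _
  have hGint : Integrable G μ'.variation := (integrable_polarDensity μ').congr hμ'
  have hle : μ.variation.withDensity d ≤ μ'.variation := Measure.withDensity_rnDeriv_le _ _
  have hg : Integrable (fun x ↦ (d x).toReal) μ.variation := Measure.integrable_toReal_rnDeriv
  have hdlt : ∀ᵐ x ∂μ.variation, d x < ∞ := Measure.rnDeriv_lt_top _ _
  refine ⟨fun x ↦ (d x).toReal, ν, fun x ↦ ENNReal.toReal_nonneg, hg, hνle,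
    Measure.mutuallySingular_singularPart _ _, ?_⟩
  -- On the absolutely continuous part d|μ'| = d · d|μ|, and G = u turns G d d|μ| into d dμ.
  have h1 : μ.withDensity (fun x ↦ (d x).toReal) (ContinuousLinearMap.lsmul ℝ ℝ) =
      (μ.variation.withDensity d).withDensityᵥ G := by
    have := withDensity_withDensityᵥ (g := fun x ↦ (d x).toReal) (integrable_polarDensity μ)
      (by rwa [variation_withDensityᵥ_polarDensity])
    rw [variation_withDensityᵥ_polarDensity] at this
    have hGd : Integrable (fun x ↦ (d x).toReal • G x) μ.variation :=
      (integrable_withDensity_iff_integrable_smul' (Measure.measurable_rnDeriv _ _) hdlt).1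
        (hGint.mono_measure hle)
    rw [this, ← withDensityᵥ_smul_eq_withDensityᵥ_withDensity'
      (Measure.measurable_rnDeriv _ _).aemeasurable hdlt hGd]
    refine WithDensityᵥEq.congr_ae ?_
    filter_upwards [hμ] with x hx
    rw [hx]
  rw [h1, add_comm, ← add_withDensityᵥ (hGint.mono_measure hνle) (hGint.mono_measure hle), ← hdec,
    ← WithDensityᵥEq.congr_ae hμ', variation_withDensityᵥ_polarDensity]

end EP2

/-! ### Description of all solutions -/

namespace EP2

open Filter Topology

variable {S Q : Set R3} (hS : IsClosed S) (hQ : IsCompact Q) (hQS : Q ⊆ Sᶜ)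
  (ρ : Measure R3) [IsFiniteMeasure ρ] (hρ : ρ.support ⊆ Q) (v : R3)

/-- The pairing equals (λ/2)(∫ g d|μ| + ν(ℝ³)), and subadditivity bounds ‖μ'‖ by the bracket.
Duality supplies the opposite inequality when μ is a solution. -/
lemma tvNorm_le_of_eq_withDensity_add {lam : ℝ} (hlam : 0 < lam) {Ψ : Lp ℝ 2 ρ}
    {μ μ' : magnetizations S}
    (hμ : ∀ᵐ x ∂μ.1.variation, adjoint ρ v Ψ x = (lam / 2) • polarDensity μ.1 x)
    {g : R3 → ℝ} {ν : Measure R3} (hg0 : ∀ x, 0 ≤ g x) (hg : Integrable g μ.1.variation)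
    [IsFiniteMeasure ν] (hν : ν.support ⊆ {x ∈ S | ‖adjoint ρ v Ψ x‖ = lam / 2})
    (h : μ'.1 = μ.1.withDensity g (ContinuousLinearMap.lsmul ℝ ℝ) +
      ν.withDensityᵥ fun x ↦ (2 / lam) • adjoint ρ v Ψ x) :
    lam / 2 * tvNorm μ'.1 ≤ inner ℝ Ψ (forward hS hQ hQS ρ hρ v μ') := by
  have hνae : ∀ᵐ x ∂ν, x ∈ S ∧ ‖adjoint ρ v Ψ x‖ = lam / 2 :=
    Filter.mem_of_superset Measure.support_mem_ae hν
  set G := adjoint ρ v Ψ with hG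
  have hGν : Integrable G ν := integrable_adjoint hS hQ hQS ρ hρ v Ψ ν
    (by filter_upwards [hνae] with x hx using hx.1)
  have hGν' : Integrable (fun x ↦ (2 / lam) • G x) ν := hGν.smul (2 / lam)
  have hgu : Integrable (fun x ↦ g x • polarDensity μ.1 x) μ.1.variation := by
    refine hg.smul_bdd 1 (measurable_polarDensity μ.1).aestronglyMeasurable ?_
    filter_upwards [norm_polarDensity μ.1] with x hx using hx.le
  have hwd : μ.1.withDensity g (ContinuousLinearMap.lsmul ℝ ℝ) =
      μ.1.variation.withDensityᵥ fun x ↦ g x • polarDensity μ.1 x := by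
    have := withDensity_withDensityᵥ (g := g) (integrable_polarDensity μ.1)
      (by rwa [variation_withDensityᵥ_polarDensity])
    rwa [variation_withDensityᵥ_polarDensity] at this
  rw [hwd] at h
  have hv1 : (μ.1.variation.withDensityᵥ fun x ↦ g x • polarDensity μ.1 x).variation =
      μ.1.variation.withDensity fun x ↦ ENNReal.ofReal (g x) := by
    rw [Measure.variation_withDensityᵥ hgu]
    refine withDensity_congr_ae ?_
    filter_upwards [norm_polarDensity μ.1] with x hx
    rw [← ofReal_norm, norm_smul, hx, mul_one, Real.norm_of_nonneg (hg0 x)]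
  have hv2 : (ν.withDensityᵥ fun x ↦ (2 / lam) • G x).variation = ν := by
    rw [Measure.variation_withDensityᵥ hGν']
    conv_rhs => rw [← withDensity_one (μ := ν)]
    refine withDensity_congr_ae ?_
    filter_upwards [hνae] with x hx
    rw [← ofReal_norm, norm_smul, hx.2, Real.norm_of_nonneg (by positivity),
      div_mul_div_cancel₀ hlam.ne', div_self two_ne_zero, ENNReal.ofReal_one, Pi.one_apply]
  have htv1 : tvNorm (μ.1.variation.withDensityᵥ fun x ↦ g x • polarDensity μ.1 x) =
      ∫ x, g x ∂μ.1.variation := by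
    rw [tvNorm, measureReal_def, hv1, withDensity_apply _ .univ, Measure.restrict_univ,
      integral_eq_lintegral_of_nonneg_ae (.of_forall hg0) hg.1]
  have htv2 : tvNorm (ν.withDensityᵥ fun x ↦ (2 / lam) • G x) = ν.real univ := by
    rw [tvNorm, hv2]
  have hfin : IsFiniteMeasure (μ.1.variation.withDensity fun x ↦ ENNReal.ofReal (g x)) :=
    isFiniteMeasure_withDensity_ofReal hg.2
  have hint1 : (μ.1.variation.withDensityᵥ fun x ↦ g x • polarDensity μ.1 x).Integrable G := by
    refine (integrable_adjoint hS hQ hQS ρ hρ v Ψ _ ?_)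
    rw [hv1]
    exact withDensity_absolutelyContinuous _ _
      ((Measure.support_subset_iff_measure_compl_eq_zero hS).1 μ.2)
  have hint2 : (ν.withDensityᵥ fun x ↦ (2 / lam) • G x).Integrable G := by
    change Integrable _ _
    rwa [hv2]
  rw [inner_forward, h, VectorMeasure.integral_add_vectorMeasure hint1 hint2,
    integral_withDensityᵥ _ hgu hint1, integral_withDensityᵥ _ hGν' hint2]
  have he1 : ∫ x, innerSL ℝ (G x) (g x • polarDensity μ.1 x) ∂μ.1.variation =
      lam / 2 * ∫ x, g x ∂μ.1.variation := by
    rw [← integral_const_mul]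
    refine integral_congr_ae ?_
    filter_upwards [hμ, norm_polarDensity μ.1] with x hx hu
    rw [innerSL_apply_apply, hx, inner_smul_left, inner_smul_right, real_inner_self_eq_norm_sq, hu]
    simp
  have he2 : ∫ x, innerSL ℝ (G x) ((2 / lam) • G x) ∂ν = lam / 2 * ν.real univ := by
    have : ∫ x, innerSL ℝ (G x) ((2 / lam) • G x) ∂ν = ∫ _, lam / 2 ∂ν := by
      refine integral_congr_ae ?_
      filter_upwards [hνae] with x hx
      rw [innerSL_apply_apply, inner_smul_right, real_inner_self_eq_norm_sq, hx.2]
      field_simp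
    rw [this, integral_const, smul_eq_mul, mul_comm]
  rw [he1, he2, ← mul_add, ← htv1, ← htv2]
  have := tvNorm_add_le (μ.1.variation.withDensityᵥ fun x ↦ g x • polarDensity μ.1 x)
    (ν.withDensityᵥ fun x ↦ (2 / lam) • G x)
  gcongr

lemma isSolution_of_eq_withDensity_add {f : Lp ℝ 2 ρ} {lam : ℝ} (hlam : 0 < lam)
    {μ μ' : magnetizations S} (hμ : IsSolution hS hQ hQS ρ hρ v f lam μ)
    (hA : forward hS hQ hQS ρ hρ v (μ' - μ) = 0) {g : R3 → ℝ} {ν : Measure R3}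
    (hg0 : ∀ x, 0 ≤ g x) (hg : Integrable g μ.1.variation) [IsFiniteMeasure ν]
    (hν : ν.support ⊆
      {x ∈ S | ‖adjoint ρ v (f - forward hS hQ hQS ρ hρ v μ) x‖ = lam / 2})
    (h : μ'.1 = μ.1.withDensity g (ContinuousLinearMap.lsmul ℝ ℝ) +
      ν.withDensityᵥ fun x ↦ (2 / lam) • adjoint ρ v (f - forward hS hQ hQS ρ hρ v μ) x) :
    IsSolution hS hQ hQS ρ hρ v f lam μ' := by
  have h1 := tvNorm_le_of_eq_withDensity_add hS hQ hQS ρ hρ v hlam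
    ((isSolution_iff_adjoint hS hQ hQS ρ hρ v f hlam.le μ).1 hμ).1 hg0 hg hν h
  have hle := (isSolution_iff_inner hS hQ hQS ρ hρ v f hlam.le μ).1 hμ
  have h2 := hle.1 μ'
  rw [forward_sub, sub_eq_zero] at hA
  rw [isSolution_iff_inner hS hQ hQS ρ hρ v f hlam.le, hA]
  rw [hA] at h1 h2
  exact ⟨hle.1, le_antisymm h2 h1⟩

lemma exists_withDensity_add_of_isSolution {f : Lp ℝ 2 ρ} {lam : ℝ} (hlam : 0 < lam)
    {μ μ' : magnetizations S} (hμ : IsSolution hS hQ hQS ρ hρ v f lam μ)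
    (hμ' : IsSolution hS hQ hQS ρ hρ v f lam μ') :
    ∃ (g : R3 → ℝ) (ν : Measure R3), (∀ x, 0 ≤ g x) ∧ Integrable g μ.1.variation ∧
      IsFiniteMeasure ν ∧ ν ⟂ₘ μ.1.variation ∧
      ν.support ⊆ {x ∈ S | ‖adjoint ρ v (f - forward hS hQ hQS ρ hρ v μ) x‖ = lam / 2} ∧
      μ'.1 = μ.1.withDensity g (ContinuousLinearMap.lsmul ℝ ℝ) +
        ν.withDensityᵥ fun x ↦ (2 / lam) • adjoint ρ v (f - forward hS hQ hQS ρ hρ v μ) x := by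
  have h1 := ((isSolution_iff_adjoint hS hQ hQS ρ hρ v f hlam.le μ).1 hμ).1
  have h2 := ((isSolution_iff_adjoint hS hQ hQS ρ hρ v f hlam.le μ').1 hμ').1
  rw [forward_eq_of_isSolution hS hQ hQS ρ hρ v hlam.le hμ hμ'] at h2
  have hpolar : ∀ {a b : R3}, a = (lam / 2) • b → b = (2 / lam) • a := by
    rintro _ b rfl
    rw [smul_smul, div_mul_div_cancel₀ hlam.ne', div_self two_ne_zero, one_smul]
  set Ψ := f - forward hS hQ hQS ρ hρ v μ
  obtain ⟨g, ν, hg0, hg, hνle, hνs, heq⟩ := exists_withDensity_add_singular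
    (G := fun x ↦ (2 / lam) • adjoint ρ v Ψ x) (h1.mono fun x hx ↦ hpolar hx)
    (h2.mono fun x hx ↦ hpolar hx)
  refine ⟨g, ν, hg0, hg, isFiniteMeasure_of_le _ hνle, hνs, ?_, heq⟩
  -- Closedness lets the support condition be checked as an a.e. statement.
  have hclosed : IsClosed {x ∈ S | ‖adjoint ρ v Ψ x‖ = lam / 2} :=
    (continuousOn_adjoint hS hQ hQS ρ hρ v Ψ).norm.preimage_isClosed_of_isClosed hS
      (isClosed_singleton (x := lam / 2))
  refine (Measure.support_mono hνle).trans
    ((Measure.support_subset_iff_measure_compl_eq_zero hclosed).2 ?_)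
  change ∀ᵐ x ∂μ'.1.variation, x ∈ S ∧ ‖adjoint ρ v Ψ x‖ = lam / 2
  filter_upwards [h2, norm_polarDensity μ'.1,
    Filter.mem_of_superset Measure.support_mem_ae μ'.2] with x hx hu hxS
  refine ⟨hxS, ?_⟩
  rw [hx, norm_smul, hu, mul_one, Real.norm_of_nonneg (by positivity)]

end EP2

end

theorem mainTheorem6 (S Q : Set EP2.R3) (hS : IsClosed S) (hQ : IsCompact Q) (hQS : Q ⊆ Sᶜ)
    (ρ : Measure EP2.R3) [IsFiniteMeasure ρ] (hρ : ρ.support ⊆ Q)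
    (v : EP2.R3) (hv : ‖v‖ = 1) (f : Lp ℝ 2 ρ) (lam : ℝ) (hlam : 0 < lam) :
    (∃ μ : EP2.magnetizations S, EP2.IsSolution hS hQ hQS ρ hρ v f lam μ) ∧
    ∀ μ : EP2.magnetizations S,
      (EP2.IsSolution hS hQ hQS ρ hρ v f lam μ ↔
        (∀ᵐ x ∂μ.1.variation,
          EP2.adjoint ρ v (f - EP2.forward hS hQ hQS ρ hρ v μ) x
            = (lam / 2) • EP2.polarDensity μ.1 x) ∧
        ∀ x ∈ S, ‖EP2.adjoint ρ v (f - EP2.forward hS hQ hQS ρ hρ v μ) x‖ ≤ lam / 2) ∧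
      (EP2.IsSolution hS hQ hQS ρ hρ v f lam μ →
        ∀ μ' : EP2.magnetizations S,
          EP2.IsSolution hS hQ hQS ρ hρ v f lam μ' ↔
            EP2.forward hS hQ hQS ρ hρ v (μ' - μ) = 0 ∧
            ∃ (g : EP2.R3 → ℝ) (ν : Measure EP2.R3),
              (∀ x, 0 ≤ g x) ∧ Integrable g μ.1.variation ∧
              IsFiniteMeasure ν ∧ ν ⟂ₘ μ.1.variation ∧
              ν.support ⊆
                {x ∈ S | ‖EP2.adjoint ρ v (f - EP2.forward hS hQ hQS ρ hρ v μ) x‖ = lam / 2} ∧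
              μ'.1 = μ.1.withDensity g (ContinuousLinearMap.lsmul ℝ ℝ) +
                ν.withDensityᵥ fun x ↦
                  (2 / lam) • EP2.adjoint ρ v (f - EP2.forward hS hQ hQS ρ hρ v μ) x) := by
  
  refine ⟨EP2.exists_isSolution hS hQ hQS ρ hρ v f hlam, fun μ ↦
    ⟨EP2.isSolution_iff_adjoint hS hQ hQS ρ hρ v f hlam.le μ, fun hμ μ' ↦ ⟨fun hμ' ↦ ⟨?_, ?_⟩, ?_⟩⟩⟩
  · rw [EP2.forward_sub, sub_eq_zero]
    exact EP2.forward_eq_of_isSolution hS hQ hQS ρ hρ v hlam.le hμ hμ'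
  · exact EP2.exists_withDensity_add_of_isSolution hS hQ hQS ρ hρ v hlam hμ hμ'
  · rintro ⟨hA, g, ν, hg0, hg, hνf, -, hν, h⟩
    exact EP2.isSolution_of_eq_withDensity_add hS hQ hQS ρ hρ v hlam hμ hA hg0 hg hν h
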